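/- Let $p$ be a prime, $n\ge 1$, $q=p^n$, and let $f:\mathbb F_q^*\to\mathbb F_p$. Call a function $g:\mathbb F_q^*\to\mathbb F_p$ balanced if it takes the value $0$ exactly $p^{n-1}-1$ times and every nonzero value exactly $p^{n-1}$ times, and call $f$ difference balanced if $x\mapsto f(ax)-f(x)$ is balanced for every $a\in\mathbb F_q^*\setminus\{1\}$. (1) For every primitive element $\theta$ of $\mathbb F_q$ and every primitive $p$-th root of unity $\zeta\in\mathbb C$, $f$ is difference balanced if and only if the sequence $s_i=f(\theta^i)$ has ideal two-level autocorrelation, that is, $\sum_{0\le i<p^n-1}\zeta^{s_{i+\tau}-s_i}$ equals $p^n-1$ if $(p^n-1)\mid\tau$ and $-1$ otherwise. (2) Let $f$ be difference balanced. Then there is exactly one $c\in\mathbb F_p$ such that $f-c$ is balanced. If $f$ is normalized so that it has exactly $p^{n-1}-1$ zeros (that is, $c=0$), then the following hold. (a) $f$ is two-tuple balanced: with $N_{b_1,b_2}(a)=|\{x\in\mathbb F_q^*:(f(x),f(ax))=(b_1,b_2)\}|$, for $a\in\mathbb F_q^*\setminus\mathbb F_p^*$ one has $N_{0,0}(a)=p^{n-2}-1$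 and $N_{b_1,b_2}(a)=p^{n-2}$ for $(b_1,b_2)\ne(0,0)$; and for each $a\in\mathbb F_p^*$ there is $\mu\in\mathbb F_p$ with $f(ax)=\mu f(x)$ for all $x$, $N_{0,0}(a)=p^{n-1}-1$, $N_{b,\mu b}(a)=p^{n-1}$ for $b\neq 0$, and $N_{b_1,b_2}(a)=0$ for $b_2\ne\mu b_1$. (b) Put $D_b=\{x\in\mathbb F_q^*:f(x)=b\}$. An $(m,k',k,\lambda_1,\lambda_2)$ divisible difference set in an abelian group $G$ of order $mk'$ with respect to a subgroup $N$ of order $k'$ is a $k$-subset $D$ such that, among the quotients $d_1d_2^{-1}$ of distinct $d_1,d_2\in D$, each non-identity element of $N$ occurs exactly $\lambda_1$ times and each element of $G\setminus N$ exactly $\lambda_2$ times; it is an $(m,k',k,\lambda_2)$ relative difference set if $\lambda_1=0$. A $(v,k,\lambda)$ difference set in a group $G$ of order $v$ is a $k$-subset for which each non-identity element of $G$ occurs exactly $\lambda$ times as such a quotient. Then, in the cyclic group $\mathbb F_q^*$ and with respect to the subgroup $\mathbb F_p^*$, the set $D_b$ is a $\left(\frac{p^n-1}{p-1},p-1,p^{n-1},p^{n-2}\right)$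 relative difference set for each $b\neq 0$, and $D_0$ is a $\left(\frac{p^n-1}{p-1},p-1,p^{n-1}-1,p^{n-1}-1,p^{n-2}-1\right)$ divisible difference set. (c) Let $\rho:\mathbb F_q^*\to\mathbb F_q^*/\mathbb F_p^*$ be the canonical epimorphism onto this cyclic group. For each $b\ne 0$, $\rho(D_b)$ is a difference set with Singer parameters $\left(\frac{p^n-1}{p-1},p^{n-1},p^{n-2}(p-1)\right)$, and $\rho(D_0)$ is the complement of $\rho(D_b)$; it is a difference set with Singer parameters $\left(\frac{p^n-1}{p-1},\frac{p^{n-1}-1}{p-1},\frac{p^{n-2}-1}{p-1}\right)$. (For $n=1$ the conditions that involve $p^{n-2}$ are vacuous.) -/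

import Mathlib

/-- The subgroup `F^*` of `K^*`, for a field extension `K / F`. -/
def baseUnits (F K : Type*) [Field F] [Field K] [Algebra F K] : Subgroup Kˣ :=
  (Units.map (algebraMap F K : F →* K)).range

/-- `f : K^* → F` is balanced, where `|F| = q` and `|K| = q ^ n`. -/
def IsBalanced {F K : Type*} [Field F] [Field K] (q n : ℕ) (f : Kˣ → F) : Prop :=
  {x : Kˣ | f x = 0}.ncard = q ^ (n - 1) - 1 ∧
    ∀ b : F, b ≠ 0 → {x : Kˣ | f x = b}.ncard = q ^ (n - 1)

/-- `f : K^* → F` is difference balanced: `x ↦ f (a x) - f x` is balanced for every `a ≠ 1`. -/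
def IsDifferenceBalanced {F K : Type*} [Field F] [Field K] (q n : ℕ) (f : Kˣ → F) : Prop :=
  ∀ a : Kˣ, a ≠ 1 → IsBalanced q n (fun x => f (a * x) - f x)

/-- The number `N_{b₁,b₂}(a)` of `x ∈ K^*` with `(f x, f (a x)) = (b₁, b₂)`. -/
noncomputable def pairCount {F K : Type*} [Field F] [Field K] (f : Kˣ → F) (a : Kˣ) (b₁ b₂ : F) :
    ℕ :=
  {x : Kˣ | (f x, f (a * x)) = (b₁, b₂)}.ncard

/-- `f : K^* → F` is two-tuple balanced, where `|F| = q` and `|K| = q ^ n`.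
The first part is void for `n = 1`, since then every `a` lies in `F^*`. -/
def IsTwoTupleBalanced {F K : Type*} [Field F] [Field K] [Algebra F K] (q n : ℕ) (f : Kˣ → F) :
    Prop :=
  (∀ a : Kˣ, a ∉ baseUnits F K →
    pairCount f a 0 0 = q ^ (n - 2) - 1 ∧
    ∀ b₁ b₂ : F, (b₁, b₂) ≠ (0, 0) → pairCount f a b₁ b₂ = q ^ (n - 2)) ∧
  (∀ a : Kˣ, a ∈ baseUnits F K → ∃ μ : F,
    (∀ x : Kˣ, f (a * x) = μ * f x) ∧
    pairCount f a 0 0 = q ^ (n - 1) - 1 ∧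
    (∀ b : F, b ≠ 0 → pairCount f a b (μ * b) = q ^ (n - 1)) ∧
    ∀ b₁ b₂ : F, b₂ ≠ μ * b₁ → pairCount f a b₁ b₂ = 0)

/-- The number of times `g` occurs in the list of differences `d₁ d₂⁻¹`, with `d₁ ≠ d₂` in `D`. -/
noncomputable def differenceCount {G : Type*} [CommGroup G] (D : Set G) (g : G) : ℕ :=
  {d : G × G | d.1 ∈ D ∧ d.2 ∈ D ∧ d.1 ≠ d.2 ∧ d.1 * d.2⁻¹ = g}.ncard

/-- `D` is an `(m, n, k, lam₁, lam₂)` divisible difference set in `G` with respect to the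
subgroup `N`: `|G| = m n`, `|N| = n`, `|D| = k`, every non-identity element of `N` occurs `lam₁`
times as a difference and every element outside `N` occurs `lam₂` times. -/
structure IsDivisibleDifferenceSet {G : Type*} [CommGroup G] (N : Subgroup G)
    (m n k lam₁ lam₂ : ℕ) (D : Set G) : Prop where
  card_group : Nat.card G = m * n
  card_subgroup : Nat.card N = n
  card_set : D.ncard = k
  inside : ∀ g : G, g ∈ N → g ≠ 1 → differenceCount D g = lam₁
  outside : ∀ g : G, g ∉ N → differenceCount D g = lam₂

/-- `D` is an `(m, n, k, lam)` difference set in `G` relative to `N`. -/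
def IsRelativeDifferenceSet {G : Type*} [CommGroup G] (N : Subgroup G)
    (m n k lam : ℕ) (D : Set G) : Prop :=
  IsDivisibleDifferenceSet N m n k 0 lam D

/-- `D` is a `(v, k, lam)` difference set in `G`. -/
structure IsDifferenceSet {G : Type*} [CommGroup G] (v k lam : ℕ) (D : Set G) : Prop where
  card_group : Nat.card G = v
  card_set : D.ncard = k
  count : ∀ g : G, g ≠ 1 → differenceCount D g = lam

/-- The autocorrelation at shift `τ` of a `p`-ary sequence `s` of period `N`, with respect to a
primitive `p`-th root of unity `ζ`. -/
noncomputable def autocorrelation {p : ℕ} (N : ℕ) (ζ : ℂ) (s : ℕ → ZMod p) (τ : ℕ) : ℂ :=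
  ∑ i ∈ Finset.range N, ζ ^ (s (i + τ) - s i).val

/-- The ideal two-level autocorrelation of a `p`-ary sequence of period `N`. -/
def HasIdealAutocorrelation {p : ℕ} (N : ℕ) (ζ : ℂ) (s : ℕ → ZMod p) : Prop :=
  ∀ τ : ℕ, (N ∣ τ → autocorrelation N ζ s τ = N) ∧ (¬ N ∣ τ → autocorrelation N ζ s τ = -1)

/-!
Adjoin to the domain `G` of `f` a point where `f` vanishes: having balanced fibers then means that
all fibers have the same size. Counting the coincidences `f (a x) = f x` for all `a` gives the sum
of the squares of the fiber sizes, which forces a unique translate of `f` to be balanced.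

For balanced `f`, put `u = ∑ x, ζ ^ (-f x⁻¹) • x` and `v = ∑ x, (ζ ^ f x - 1) • x` in the group
algebra of `G` over `ℤ[ζ]`. Difference balance makes every coefficient of `u * v` divisible by
`p ^ n = |G| + 1`. Modulo `ζ - 1` the group algebra satisfies `z ^ p ^ n = z`, so it is von Neumann
regular, and divisibility by a power of `ζ - 1` survives applying the automorphism `ζ ↦ ζ ^ t` to
the factor `u` alone. The coefficients of the new product are `∑ x, ζ ^ (f (a x) - t * f x) + 1`,
and their divisibility by `p ^ n` leaves only two cases: `x ↦ f (a x) - t * f x` is balanced or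
identically zero. Counting again, each `t ≠ 0` has exactly one `a` of the second kind, and these `a`
form a subgroup of order `p - 1`, which for `G = K^*` is the group of units of the prime field. For
`a` outside it, counting the points `(f x, f (a x))` on the lines of the plane over `𝔽_p` shows
that all nonzero pairs occur equally often; the difference sets are read off from this.
-/

theorem pow_dvd_map_mul_of_pow_dvd_mul {A : Type*} [CommRing A] {π : A} (hπ : IsLeftRegular π)
    (hreg : ∀ x : A, ∃ y, π ∣ x - x * x * y) {σ : A →+* A} (hσ : ∀ x : A, π ∣ σ x - x)
    {m : ℕ} {u v : A} (huv : π ^ m ∣ u * v) : π ^ m ∣ σ u * v := by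
  induction m generalizing u v with
  | zero => simp
  | succ m ih =>
    -- Modulo `π`, the element `e = u * y` is an idempotent generating the same ideal as `u`, so
    -- that `e * v` and `u * (1 - e)` are multiples of `π`.
    obtain ⟨y, z, hz⟩ := hreg u
    obtain ⟨w, hw⟩ : π ∣ u * y * v :=
      ((dvd_pow_self π m.succ_ne_zero).trans huv).trans ⟨y, by ring⟩
    have on_e : π ^ (m + 1) ∣ σ u * (u * y * v) := by
      have huw : π ^ m ∣ u * w := by
        rw [← hπ.dvd_cancel_left, ← pow_succ']
        exact huv.trans ⟨u * y, by linear_combination (-u) * hw⟩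
      rw [hw, mul_left_comm, pow_succ']
      exact mul_dvd_mul_left π (ih huw)
    have off_e : π ^ (m + 1) ∣ σ (u - u * u * y) * v := by
      have hzv : π ^ m ∣ z * v := by
        rw [← hπ.dvd_cancel_left, ← pow_succ']
        exact huv.trans ⟨1 - u * y, by linear_combination (-v) * hz⟩
      have hσπ : π ∣ σ π := (dvd_sub_left (dvd_refl π)).1 (hσ π)
      rw [hz, map_mul, mul_assoc, pow_succ']
      exact mul_dvd_mul hσπ (ih hzv)
    obtain ⟨r, hr⟩ := hσ (u * y)
    have hsum : π ^ (m + 1) ∣ (1 - π * r) * (σ u * v) := by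
      refine (dvd_add on_e off_e).trans (dvd_of_eq ?_)
      simp only [map_sub, map_mul] at hr ⊢
      linear_combination (-σ u * v) * hr
    have hcoprime : IsCoprime (π ^ (m + 1)) (1 - π * r) := .pow_left ⟨r, 1, by ring⟩
    exact hcoprime.dvd_of_dvd_mul_left hsum

theorem associated_zeta_sub_one_pow_prime {R : Type*} [CommRing R] [IsDomain R] {p : ℕ}
    [hp : Fact p.Prime] {ζ : R} (hζ : IsPrimitiveRoot ζ p) :
    Associated ((ζ - 1) ^ (p - 1)) (p : R) := by
  obtain ⟨m, rfl⟩ : ∃ m, p = m + 1 := ⟨p - 1, (Nat.sub_add_cancel hp.out.one_le).symm⟩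
  rw [Nat.add_sub_cancel, Nat.cast_add_one, ← hζ.prod_one_sub_pow_eq_order,
    ← Finset.card_range m, ← Finset.prod_const, Finset.card_range]
  refine Associated.prod _ _ _ fun j hj => ?_
  have hcoprime : (j + 1).Coprime (m + 1) :=
    Nat.coprime_comm.1 <| Nat.coprime_of_lt_prime j.succ_ne_zero (by simpa using hj) hp.out
  rw [← neg_sub _ (1 : R), Associated.neg_right_iff]
  exact hζ.associated_sub_one_pow_sub_one_of_coprime hcoprime

section Cyclotomic

open Polynomial

theorem coeff_eq_of_cyclotomic_dvd {R : Type*} [CommRing R] {p : ℕ} [hp : Fact p.Prime] {P : R[X]}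
    (hP : P.natDegree < p) (h : cyclotomic p R ∣ P) {i : ℕ} (hi : i < p) :
    P.coeff i = P.coeff 0 := by
  nontriviality R
  obtain ⟨Q, rfl⟩ := h
  obtain rfl | hQ := eq_or_ne Q 0
  · simp
  have hQ0 : Q.natDegree = 0 := by
    rw [(cyclotomic.monic p R).natDegree_mul' hQ, natDegree_cyclotomic,
      Nat.totient_prime hp.out] at hP
    omega
  rw [eq_C_of_natDegree_eq_zero hQ0, cyclotomic_prime]
  simp [finsetSum_coeff, coeff_X_pow, hi, hp.out.pos]

theorem eq_of_cyclotomic_dvd_sum {R : Type*} [CommRing R] {p : ℕ} [hp : Fact p.Prime]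
    {c : ZMod p → R} (h : cyclotomic p R ∣ ∑ b, C (c b) * X ^ b.val) (b b' : ZMod p) :
    c b = c b' := by
  have hcoeff (b : ZMod p) : (∑ b, C (c b) * X ^ b.val : R[X]).coeff b.val = c b := by
    simp [finsetSum_coeff, coeff_X_pow, (ZMod.val_injective p).eq_iff]
  have hdeg : (∑ b, C (c b) * X ^ b.val : R[X]).natDegree < p :=
    (natDegree_sum_le_of_forall_le _ _ fun b _ => (natDegree_C_mul_X_pow_le _ _).trans
      (Nat.le_pred_of_lt b.val_lt)).trans_lt (Nat.pred_lt hp.out.ne_zero)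
  rw [← hcoeff b, ← hcoeff b', coeff_eq_of_cyclotomic_dvd hdeg h b.val_lt,
    coeff_eq_of_cyclotomic_dvd hdeg h b'.val_lt]

theorem zmodChar_ne_one_of_isPrimitiveRoot {C : Type*} [CommMonoid C] {n : ℕ} [NeZero n]
    [Fact (1 < n)] {ζ : C} (hζ : IsPrimitiveRoot ζ n) :
    AddChar.zmodChar n hζ.pow_eq_one ≠ 1 := by
  simpa using AddChar.zmodChar_primitive_of_primitive_root n hζ one_ne_zero

/-- The ring `ℤ[ζ]` generated by a primitive `p`-th root of unity, for `p` prime. -/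
abbrev CyclotomicInt (p : ℕ) : Type := AdjoinRoot (cyclotomic p ℤ)

namespace CyclotomicInt

variable {p : ℕ}

variable (p) in
/-- The distinguished `p`-th root of unity of `ℤ[ζ]`. -/
noncomputable abbrev zeta : CyclotomicInt p := AdjoinRoot.root (cyclotomic p ℤ)

variable [hp : Fact p.Prime]

instance : IsDomain (CyclotomicInt p) :=
  AdjoinRoot.isDomain_of_prime (cyclotomic.irreducible hp.out.pos).prime

instance : CharZero (CyclotomicInt p) := by
  refine charZero_of_injective_algebraMap (R := ℤ) (AdjoinRoot.of.injective_of_degree_ne_zero ?_)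
  exact (degree_cyclotomic_pos p ℤ hp.out.pos).ne'

theorem isPrimitiveRoot_zeta : IsPrimitiveRoot (zeta p) p := by
  have : NeZero (p : CyclotomicInt p) := ⟨Nat.cast_ne_zero.2 hp.out.ne_zero⟩
  rw [← isRoot_cyclotomic_iff, ← map_cyclotomic_int p (CyclotomicInt p)]
  exact AdjoinRoot.isRoot_root _

theorem zeta_sub_one_ne_zero : zeta p - 1 ≠ 0 :=
  sub_ne_zero.2 (isPrimitiveRoot_zeta.ne_one hp.out.one_lt)

variable (p) in
/-- The additive character `b ↦ ζ ^ b` of `ZMod p` with values in `ℤ[ζ]`. -/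
noncomputable def char : AddChar (ZMod p) (CyclotomicInt p) :=
  AddChar.zmodChar p isPrimitiveRoot_zeta.pow_eq_one

theorem char_apply (b : ZMod p) : char p b = zeta p ^ b.val := AddChar.zmodChar_apply _ _

theorem char_ne_one : char p ≠ 1 :=
  zmodChar_ne_one_of_isPrimitiveRoot isPrimitiveRoot_zeta

variable (p) in
/-- The residue map of `ℤ[ζ]` at its prime `ζ - 1` above `p`. -/
noncomputable def residue : CyclotomicInt p →+* ZMod p :=
  AdjoinRoot.lift (Int.castRingHom (ZMod p)) 1 <| by
    rw [← eval_map, map_cyclotomic_int, eval_one_cyclotomic_prime, ZMod.natCast_self]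

theorem residue_zeta : residue p (zeta p) = 1 := AdjoinRoot.lift_root _

theorem residue_eq_zero_iff {x : CyclotomicInt p} : residue p x = 0 ↔ zeta p - 1 ∣ x := by
  refine ⟨fun hx => ?_, ?_⟩
  · obtain ⟨P, rfl⟩ := AdjoinRoot.mk_surjective x
    have hsub : zeta p - 1 ∣ AdjoinRoot.mk _ P - ((P.eval 1 : ℤ) : CyclotomicInt p) := by
      simpa using
        map_dvd (AdjoinRoot.mk (cyclotomic p ℤ)) (X_sub_C_dvd_sub_C_eval (a := 1) (p := P))
    have heval : (p : ℤ) ∣ P.eval 1 := by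
      rw [residue, AdjoinRoot.lift_mk, eval₂_at_one, eq_intCast] at hx
      exact (ZMod.intCast_zmod_eq_zero_iff_dvd _ _).1 hx
    have hp_dvd : zeta p - 1 ∣ (p : CyclotomicInt p) :=
      (dvd_pow_self _ (Nat.sub_ne_zero_of_lt hp.out.one_lt)).trans
        (associated_zeta_sub_one_pow_prime isPrimitiveRoot_zeta).dvd
    refine (dvd_iff_dvd_of_dvd_sub hsub).2 (hp_dvd.trans ?_)
    exact_mod_cast map_dvd (Int.castRingHom (CyclotomicInt p)) heval
  · rintro ⟨y, rfl⟩
    rw [map_mul, map_sub, residue_zeta, map_one, sub_self, zero_mul]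

/-- The endomorphism of `ℤ[ζ]` with `ζ ↦ ζ ^ t`. -/
noncomputable def galois (t : (ZMod p)ˣ) : CyclotomicInt p →+* CyclotomicInt p :=
  AdjoinRoot.lift (Int.castRingHom _) (zeta p ^ (t : ZMod p).val) <| by
    rw [← eval_map, map_cyclotomic_int]
    exact (isPrimitiveRoot_zeta.pow_of_coprime _ (ZMod.val_coe_unit_coprime t)).isRoot_cyclotomic
      hp.out.pos

theorem galois_char (t : (ZMod p)ˣ) (b : ZMod p) : galois t (char p b) = char p (t * b) := by
  rw [char_apply, map_pow, galois, AdjoinRoot.lift_root, ← char_apply, ← AddChar.map_nsmul_eq_pow,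
    nsmul_eq_mul, ZMod.natCast_zmod_val, mul_comm]

theorem residue_comp_galois (t : (ZMod p)ˣ) : (residue p).comp (galois t) = residue p := by
  refine AdjoinRoot.ringHom_ext (RingHom.ext_int _ _) ?_
  rw [RingHom.comp_apply, galois, AdjoinRoot.lift_root, map_pow, residue_zeta, one_pow]

theorem dvd_sub_of_dvd_sum_char {N : ℕ} {c : ZMod p → ℤ}
    (h : (N : CyclotomicInt p) ∣ ∑ b, (c b : CyclotomicInt p) * char p b) (b b' : ZMod p) :
    (N : ℤ) ∣ c b - c b' := by
  obtain ⟨y, hy⟩ := h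
  obtain ⟨Q, rfl⟩ := AdjoinRoot.mk_surjective y
  have hmk : AdjoinRoot.mk (cyclotomic p ℤ) (∑ b, C (c b) * X ^ b.val) =
      AdjoinRoot.mk (cyclotomic p ℤ) (C (N : ℤ) * Q) := by
    simpa [char_apply] using hy
  have hmod : cyclotomic p (ZMod N) ∣ ∑ b, C (c b : ZMod N) * X ^ b.val := by
    simpa [Polynomial.map_sum] using
      Polynomial.map_dvd (Int.castRingHom (ZMod N)) (AdjoinRoot.mk_eq_mk.1 hmk)
  rw [← ZMod.intCast_zmod_eq_zero_iff_dvd, Int.cast_sub, sub_eq_zero]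
  exact eq_of_cyclotomic_dvd_sum hmod b b'

end CyclotomicInt

end Cyclotomic

section GroupAlgebra

open MonoidAlgebra

/-- The element `∑ x, α x • x` of the group algebra. -/
noncomputable def groupSum {G R : Type*} [Fintype G] [Semiring R] (α : G → R) :
    MonoidAlgebra R G :=
  ∑ x, single x (α x)

theorem coeff_groupSum {G R : Type*} [Fintype G] [Semiring R] (α : G → R) (a : G) :
    (groupSum α).coeff a = α a := by
  classical
  simp [groupSum, coeff_single, Finsupp.single_apply]

theorem coeff_groupSum_mul_groupSum_inv {G R : Type*} [Group G] [Fintype G] [Semiring R]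
    (α β : G → R) (a : G) :
    (groupSum α * groupSum fun x => β x⁻¹).coeff a = ∑ y, α (a * y) * β y := by
  classical
  simp only [groupSum, Finset.sum_mul_sum, single_mul_single, coeff_sum, coeff_single,
    Finsupp.finsetSum_apply, Finsupp.single_apply]
  rw [Finset.sum_comm, ← Equiv.sum_comp (Equiv.inv G)]
  simp [mul_inv_eq_iff_eq_mul]

theorem isLeftRegular_single_one {G R : Type*} [Monoid G] [Semiring R] {c : R}
    (hc : IsLeftRegular c) : IsLeftRegular (single 1 c : MonoidAlgebra R G) := fun x y h => by
  ext a
  have hcoeff := congrArg (MonoidAlgebra.coeff · a) h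
  simp only [coeff_single_one_mul] at hcoeff
  exact hc hcoeff

theorem single_one_dvd_iff {G R : Type*} [Monoid G] [Finite G] [Semiring R] {c : R}
    {x : MonoidAlgebra R G} : single 1 c ∣ x ↔ ∀ a, c ∣ x.coeff a := by
  refine ⟨?_, fun h => ?_⟩
  · rintro ⟨y, rfl⟩ a
    rw [coeff_single_one_mul]
    exact dvd_mul_right _ _
  · have := Fintype.ofFinite G
    choose y hy using h
    refine ⟨groupSum y, ?_⟩
    ext a
    rw [coeff_single_one_mul, coeff_groupSum, hy]

theorem groupAlgebra_pow_card {G : Type*} [CommGroup G] {p k : ℕ} [Fact p.Prime]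
    (hG : Nat.card G + 1 = p ^ k) (z : MonoidAlgebra (ZMod p) G) : z ^ p ^ k = z := by
  have : CharP (MonoidAlgebra (ZMod p) G) p :=
    charP_of_injective_algebraMap (algebraMap (ZMod p) _).injective p
  have hid : iterateFrobenius (MonoidAlgebra (ZMod p) G) p k = RingHom.id _ := by
    refine MonoidAlgebra.ringHom_ext (fun r => ?_) fun g => ?_
    · simp [iterateFrobenius_def, single_pow, ZMod.pow_card_pow]
    · simp [iterateFrobenius_def, single_pow, ← hG, pow_succ]
  exact DFunLike.congr_fun hid z

end GroupAlgebra

section Multiplier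

open MonoidAlgebra CyclotomicInt

variable {p : ℕ} [hp : Fact p.Prime] {G : Type*} [CommGroup G] [Finite G]

theorem single_zeta_sub_one_dvd_iff {x : MonoidAlgebra (CyclotomicInt p) G} :
    single 1 (zeta p - 1) ∣ x ↔ mapRingHom G (residue p) x = 0 := by
  simp only [single_one_dvd_iff, ← residue_eq_zero_iff, ← coeff_mapRingHom]
  exact ⟨fun h => MonoidAlgebra.ext (Finsupp.ext h), fun h a => by rw [h]; rfl⟩

theorem single_zeta_sub_one_pow_dvd_iff {m : ℕ} {x : MonoidAlgebra (CyclotomicInt p) G} :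
    single 1 (zeta p - 1) ^ ((p - 1) * m) ∣ x ↔ ∀ a, (p : CyclotomicInt p) ^ m ∣ x.coeff a := by
  have hassoc : Associated ((zeta p - 1) ^ ((p - 1) * m)) ((p : CyclotomicInt p) ^ m) := by
    rw [pow_mul]
    exact (associated_zeta_sub_one_pow_prime isPrimitiveRoot_zeta).pow_pow
  simp only [single_pow, one_pow, single_one_dvd_iff, hassoc.dvd_iff_dvd_left]

theorem prime_pow_dvd_coeff_map_galois_mul {k m : ℕ} (hG : Nat.card G + 1 = p ^ k)
    (t : (ZMod p)ˣ) {u v : MonoidAlgebra (CyclotomicInt p) G}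
    (huv : ∀ a, (p : CyclotomicInt p) ^ m ∣ (u * v).coeff a) (a : G) :
    (p : CyclotomicInt p) ^ m ∣ (mapRingHom G (galois t) u * v).coeff a := by
  have hcard : 2 ≤ p ^ k := hG ▸ Nat.succ_le_succ Nat.card_pos
  have hregular (x : MonoidAlgebra (CyclotomicInt p) G) :
      single 1 (zeta p - 1) ∣ x - x * x * x ^ (p ^ k - 2) := by
    rw [single_zeta_sub_one_dvd_iff, map_sub, ← pow_two, ← pow_add, Nat.add_sub_cancel' hcard,
      map_pow, groupAlgebra_pow_card hG, sub_self]
  have hgalois (x : MonoidAlgebra (CyclotomicInt p) G) :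
      single 1 (zeta p - 1) ∣ mapRingHom G (galois t) x - x := by
    rw [single_zeta_sub_one_dvd_iff, map_sub, ← RingHom.comp_apply, ← mapRingHom_comp,
      residue_comp_galois, sub_self]
  have hzeta : IsLeftRegular (single 1 (zeta p - 1) : MonoidAlgebra (CyclotomicInt p) G) :=
    isLeftRegular_single_one (IsLeftCancelMulZero.mul_left_cancel_of_ne_zero zeta_sub_one_ne_zero)
  revert a
  rw [← single_zeta_sub_one_pow_dvd_iff] at huv ⊢
  exact pow_dvd_map_mul_of_pow_dvd_mul hzeta (fun x => ⟨_, hregular x⟩) hgalois huv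

end Multiplier

/-- Every fiber of `g` has `P` elements. -/
def Equidistributed {Y F : Type*} (P : ℕ) (g : Y → F) : Prop :=
  ∀ b, {y | g y = b}.ncard = P

theorem ncard_setOf_eq_sum_ite {X : Type*} [Fintype X] (r : X → Prop) [DecidablePred r] :
    {x | r x}.ncard = ∑ x, if r x then 1 else 0 := by
  rw [Set.ncard_eq_toFinset_card', Set.toFinset_ofPred, Finset.card_filter]

section Equidistributed

variable {Y F : Type*}

theorem sum_comp_eq_sum_ncard_nsmul [Fintype Y] [Fintype F] {M : Type*} [AddCommMonoid M]
    (φ : F → M) (g : Y → F) : ∑ y, φ (g y) = ∑ b, {y | g y = b}.ncard • φ b := by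
  classical
  rw [← Fintype.sum_fiberwise' g φ]
  refine Finset.sum_congr rfl fun b _ => ?_
  rw [Finset.sum_const, Finset.card_univ, ← Nat.card_eq_fintype_card, ← Nat.card_coe_set_eq]
  rfl

theorem sum_ncard_fiber [Finite Y] [Fintype F] (g : Y → F) :
    ∑ b, {y | g y = b}.ncard = Nat.card Y := by
  have := Fintype.ofFinite Y
  simpa [Nat.card_eq_fintype_card] using (sum_comp_eq_sum_ncard_nsmul (fun _ => (1 : ℕ)) g).symm

theorem equidistributed_of_forall_ncard_eq [Finite Y] [Finite F] {P : ℕ}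
    (hY : Nat.card Y = Nat.card F * P) {g : Y → F}
    (hg : ∀ b b', {y | g y = b}.ncard = {y | g y = b'}.ncard) : Equidistributed P g := fun b => by
  have := Fintype.ofFinite F
  have : Nonempty F := ⟨b⟩
  have hsum := sum_ncard_fiber g
  simp only [hg _ b, Finset.sum_const, Finset.card_univ, smul_eq_mul, hY,
    ← Nat.card_eq_fintype_card] at hsum
  exact Nat.eq_of_mul_eq_mul_left Nat.card_pos hsum

namespace Equidistributed

variable {P : ℕ} {g : Y → F}

theorem sum_comp [Fintype Y] [Fintype F] (hg : Equidistributed P g) {M : Type*} [AddCommMonoid M]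
    (φ : F → M) : ∑ y, φ (g y) = P • ∑ b, φ b := by
  simp only [sum_comp_eq_sum_ncard_nsmul φ g, hg _, Finset.smul_sum]

theorem ncard_preimage [Finite Y] [Finite F] (hg : Equidistributed P g) (S : Set F) :
    {y | g y ∈ S}.ncard = P * S.ncard := by
  classical
  have := Fintype.ofFinite Y
  have := Fintype.ofFinite F
  rw [ncard_setOf_eq_sum_ite, hg.sum_comp fun b => if b ∈ S then 1 else 0,
    ← ncard_setOf_eq_sum_ite, Set.ofPred_mem_eq, smul_eq_mul]

theorem comp_equiv {Z : Type*} (hg : Equidistributed P g) (e : Z ≃ Y) :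
    Equidistributed P (g ∘ e) := fun b => by
  change (e ⁻¹' {y | g y = b}).ncard = P
  rw [Set.ncard_preimage_of_injective_subset_range e.injective (by simp), hg b]

theorem equiv_comp {F' : Type*} (hg : Equidistributed P g) (e : F ≃ F') :
    Equidistributed P (e ∘ g) := fun b => by
  simpa only [Function.comp_apply, ← Equiv.eq_symm_apply] using hg (e.symm b)

end Equidistributed

variable {p P : ℕ} [hp : Fact p.Prime] [Fintype Y] {g : Y → ZMod p}

theorem equidistributed_or_forall_eq (hY : Nat.card Y = p * P)
    (h : (Nat.card Y : CyclotomicInt p) ∣ ∑ y, CyclotomicInt.char p (g y)) :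
    Equidistributed P g ∨ ∃ b, ∀ y, g y = b := by
  by_cases hg : ∀ b b', {y | g y = b}.ncard = {y | g y = b'}.ncard
  · exact .inl (equidistributed_of_forall_ncard_eq (by rwa [Nat.card_zmod]) hg)
  right
  push Not at hg
  obtain ⟨b, b', hlt⟩ : ∃ b b', {y | g y = b'}.ncard < {y | g y = b}.ncard := by
    obtain ⟨b, b', hne⟩ := hg
    exact hne.lt_or_gt.elim (fun h => ⟨b', b, h⟩) fun h => ⟨b, b', h⟩
  have hdvd : (Nat.card Y : ℤ) ∣ {y | g y = b}.ncard - {y | g y = b'}.ncard := by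
    refine CyclotomicInt.dvd_sub_of_dvd_sum_char (c := fun b => {y | g y = b}.ncard) ?_ b b'
    simpa [sum_comp_eq_sum_ncard_nsmul] using h
  have hfull : {y | g y = b} = Set.univ := by
    refine Set.eq_of_subset_of_ncard_le (Set.subset_univ _) ?_
    have := Int.le_of_dvd (by omega) hdvd
    rw [Set.ncard_univ]
    omega
  exact ⟨b, Set.eq_univ_iff_forall.1 hfull⟩

theorem equidistributed_iff_sum_pow_eq_zero {K : Type*} [Field K] [CharZero K] {ζ : K}
    (hζ : IsPrimitiveRoot ζ p) (hY : Nat.card Y = p * P) :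
    Equidistributed P g ↔ ∑ y, ζ ^ (g y).val = 0 := by
  refine ⟨fun hg => ?_, fun h => equidistributed_of_forall_ncard_eq (by rwa [Nat.card_zmod]) ?_⟩
  · simp only [← AddChar.zmodChar_apply hζ.pow_eq_one]
    rw [hg.sum_comp, AddChar.sum_eq_zero_of_ne_one (zmodChar_ne_one_of_isPrimitiveRoot hζ),
      smul_zero]
  · open Polynomial in
    have hdvd : cyclotomic p ℤ ∣ ∑ b : ZMod p, C ({y | g y = b}.ncard : ℤ) * X ^ b.val := by
      rw [cyclotomic_eq_minpoly hζ hp.out.pos]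
      refine minpoly.isIntegrallyClosed_dvd (hζ.isIntegral hp.out.pos) ?_
      simpa [sum_comp_eq_sum_ncard_nsmul fun b : ZMod p => ζ ^ b.val] using h
    exact fun b b' => Int.ofNat_inj.1 (eq_of_cyclotomic_dvd_sum hdvd b b')

end Equidistributed

/-- The extension of `g` by the value `0` at one extra point, which stands for the zero of a field
when `X` is its group of units. -/
def extendZero {X F : Type*} [Zero F] (g : X → F) : Option X → F := fun o => o.elim 0 g

/-- Every nonzero value has `P` preimages under `g`, and `0` has one less: the notion `IsBalanced`
for a function on any type. -/
def HasBalancedFibers {X F : Type*} [Zero F] (P : ℕ) (g : X → F) : Prop :=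
  Equidistributed P (extendZero g)

section HasBalancedFibers

variable {X F : Type*}

theorem sum_comp_extendZero [Fintype X] [Zero F] {M : Type*} [AddCommMonoid M] (φ : F → M)
    (g : X → F) : ∑ o, φ (extendZero g o) = φ 0 + ∑ x, φ (g x) :=
  Fintype.sum_option _

theorem hasBalancedFibers_iff [Finite X] [Zero F] {P : ℕ} {g : X → F} :
    HasBalancedFibers P g ↔
      {x | g x = 0}.ncard + 1 = P ∧ ∀ b, b ≠ 0 → {x | g x = b}.ncard = P := by
  classical
  have := Fintype.ofFinite X
  have hcard (b : F) : {o | extendZero g o = b}.ncard =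
      (if 0 = b then 1 else 0) + {x | g x = b}.ncard := by
    simp only [ncard_setOf_eq_sum_ite, sum_comp_extendZero fun y => if y = b then 1 else 0]
  simp only [HasBalancedFibers, Equidistributed, hcard]
  refine ⟨fun h => ⟨by simpa [add_comm] using h 0, fun b hb => by simpa [hb.symm] using h b⟩, ?_⟩
  rintro ⟨h₀, h⟩ b
  obtain rfl | hb := eq_or_ne b 0
  · rw [if_pos rfl, add_comm, h₀]
  · rw [if_neg hb.symm, zero_add, h b hb]

theorem hasBalancedFibers_sub_const_iff [Finite X] [AddGroup F] {P : ℕ} {g : X → F} {c : F} :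
    HasBalancedFibers P (fun x => g x - c) ↔
      {x | g x = c}.ncard + 1 = P ∧ ∀ b, b ≠ c → {x | g x = b}.ncard = P := by
  rw [hasBalancedFibers_iff]
  simp only [sub_eq_iff_eq_add, zero_add]
  refine and_congr_right fun _ => ⟨fun h b hb => ?_, fun h b hb => h _ (by simpa using hb)⟩
  simpa using h (b - c) (sub_ne_zero.2 hb)

namespace HasBalancedFibers

variable {P : ℕ} {g : X → F}

theorem comp_equiv [Zero F] {Z : Type*} (hg : HasBalancedFibers P g) (e : Z ≃ X) :
    HasBalancedFibers P fun z => g (e z) := by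
  have hcomp : extendZero (fun z => g (e z)) = extendZero g ∘ Equiv.optionCongr e := by
    funext o
    cases o <;> rfl
  rw [HasBalancedFibers, hcomp]
  exact Equidistributed.comp_equiv hg _

theorem mul_left [GroupWithZero F] (hg : HasBalancedFibers P g) {c : F} (hc : c ≠ 0) :
    HasBalancedFibers P fun x => c * g x := by
  have hcomp : extendZero (fun x => c * g x) = Equiv.mulLeft₀ c hc ∘ extendZero g := by
    funext o
    cases o
    · exact (mul_zero c).symm
    · rfl
  rw [HasBalancedFibers, hcomp]
  exact Equidistributed.equiv_comp hg _

theorem exists_eq [Finite X] [Zero F] (hg : HasBalancedFibers P g) (hP : P ≠ 0) {b : F}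
    (hb : b ≠ 0) : ∃ x, g x = b :=
  Set.nonempty_of_ncard_ne_zero ((hasBalancedFibers_iff.1 hg).2 b hb ▸ hP)

theorem ncard_preimage [Finite X] [Finite F] [Zero F] (hg : HasBalancedFibers P g) {S : Set F}
    (hS : 0 ∉ S) : {x | g x ∈ S}.ncard = P * S.ncard := by
  classical
  have := Fintype.ofFinite X
  rw [← Equidistributed.ncard_preimage hg S, ncard_setOf_eq_sum_ite, ncard_setOf_eq_sum_ite,
    sum_comp_extendZero fun y => if y ∈ S then 1 else 0, if_neg hS, zero_add]

theorem sum_addChar [Fintype X] [Finite F] [AddGroup F] (hg : HasBalancedFibers P g)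
    {R : Type*} [CommRing R] [IsDomain R] {ψ : AddChar F R} (hψ : ψ ≠ 1) :
    ∑ x, ψ (g x) = -1 := by
  have := Fintype.ofFinite F
  refine eq_neg_of_add_eq_zero_right ?_
  rw [← ψ.map_zero_eq_one, ← sum_comp_extendZero, Equidistributed.sum_comp hg,
    AddChar.sum_eq_zero_of_ne_one hψ, smul_zero]

end HasBalancedFibers

variable {p P : ℕ} [Fact p.Prime] [Fintype X] {g : X → ZMod p}

theorem hasBalancedFibers_or_forall_eq_zero (hX : Nat.card X + 1 = p * P)
    (h : ((p * P : ℕ) : CyclotomicInt p) ∣ ∑ x, CyclotomicInt.char p (g x) + 1) :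
    HasBalancedFibers P g ∨ ∀ x, g x = 0 := by
  have hY : Nat.card (Option X) = p * P := by rw [Finite.card_option, hX]
  rw [add_comm, ← (CyclotomicInt.char p).map_zero_eq_one, ← sum_comp_extendZero, ← hY] at h
  refine (equidistributed_or_forall_eq hY h).imp_right ?_
  rintro ⟨b, hb⟩ x
  exact (hb (some x)).trans (hb none).symm

theorem hasBalancedFibers_iff_sum_pow_eq_neg_one (hX : Nat.card X + 1 = p * P)
    {K : Type*} [Field K] [CharZero K] {ζ : K} (hζ : IsPrimitiveRoot ζ p) :
    HasBalancedFibers P g ↔ ∑ x, ζ ^ (g x).val = -1 := by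
  rw [HasBalancedFibers, equidistributed_iff_sum_pow_eq_zero hζ (by rw [Finite.card_option, hX]),
    sum_comp_extendZero fun b : ZMod p => ζ ^ b.val, ZMod.val_zero, pow_zero, add_comm,
    add_eq_zero_iff_eq_neg]

end HasBalancedFibers

/-- The function `x ↦ f (a x) - f x` has balanced fibers for every `a ≠ 1`: the notion
`IsDifferenceBalanced` for a function on any group. -/
def HasBalancedDifferences {G F : Type*} [Monoid G] [AddGroup F] (P : ℕ) (f : G → F) : Prop :=
  ∀ a, a ≠ 1 → HasBalancedFibers P fun x => f (a * x) - f x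

section BalancedTranslate

theorem sum_ncard_fiber_eq_sum_ncard_coincidence {G F : Type*} [Group G] [Fintype G]
    (α β : G → F) : ∑ y, {x | α x = β y}.ncard = ∑ a, {y | α (a * y) = β y}.ncard := by
  classical
  simp only [ncard_setOf_eq_sum_ite]
  refine (Finset.sum_congr rfl fun y _ => ?_).trans Finset.sum_comm
  exact (Equiv.sum_comp (Equiv.mulRight y) fun x => if α x = β y then 1 else 0).symm

theorem exists_eq_neg_one_of_sum_eq {ι : Type*} [Fintype ι] {M : ι → ℤ} (h₁ : ∑ i, M i = -1)
    (h₂ : ∑ i, M i ^ 2 = 1) : ∃ i, M i = -1 ∧ ∀ j, j ≠ i → M j = 0 := by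
  classical
  obtain ⟨i, -, hi⟩ := Finset.exists_ne_zero_of_sum_ne_zero (h₁.trans_ne (by norm_num))
  have hzero (j) (hj : j ≠ i) : M j = 0 := by
    have hpair : M i ^ 2 + M j ^ 2 ≤ ∑ i, M i ^ 2 := by
      rw [← Finset.sum_pair (f := fun i => M i ^ 2) hj.symm]
      exact Finset.sum_le_univ_sum_of_nonneg fun _ => sq_nonneg _
    have hpos : 0 < M i ^ 2 := by positivity
    exact pow_eq_zero_iff two_ne_zero |>.1 (le_antisymm (by linarith) (sq_nonneg _))
  refine ⟨i, ?_, hzero⟩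
  rwa [Fintype.sum_eq_single i hzero] at h₁

variable {G F : Type*} [Group G] [Finite G] [AddGroup F] {P : ℕ} {f : G → F}

theorem HasBalancedDifferences.sum_sq_ncard_fiber [Fintype F] (hd : HasBalancedDifferences P f) :
    ∑ b, ({x | f x = b}.ncard : ℤ) ^ 2 = Nat.card G + (Nat.card G - 1) * (P - 1) := by
  classical
  have := Fintype.ofFinite G
  have hne (a : G) (ha : a ∈ Finset.univ.erase 1) :
      ({y | f (a * y) = f y}.ncard : ℤ) = P - 1 := by
    have := (hasBalancedFibers_iff.1 (hd a (Finset.ne_of_mem_erase ha))).1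
    simp only [sub_eq_zero] at this
    omega
  calc ∑ b, ({x | f x = b}.ncard : ℤ) ^ 2
      = ∑ y, ({x | f x = f y}.ncard : ℤ) := by
        rw [sum_comp_eq_sum_ncard_nsmul fun b => ({x | f x = b}.ncard : ℤ)]
        simp only [nsmul_eq_mul, pow_two]
    _ = ∑ a, ({y | f (a * y) = f y}.ncard : ℤ) :=
        mod_cast sum_ncard_fiber_eq_sum_ncard_coincidence f f
    _ = Nat.card G + (Nat.card G - 1) * (P - 1) := by
        rw [← Finset.add_sum_erase _ _ (Finset.mem_univ 1), Finset.sum_congr rfl hne]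
        simp [Set.ncard_univ, Nat.cast_sub Fintype.card_pos, mul_sub]

theorem HasBalancedDifferences.existsUnique_hasBalancedFibers_sub [Finite F]
    (hd : HasBalancedDifferences P f) (hG : Nat.card G + 1 = Nat.card F * P) :
    ∃! c, HasBalancedFibers P fun x => f x - c := by
  have := Fintype.ofFinite F
  have hcard : (Nat.card G : ℤ) = Nat.card F * P - 1 := by
    rw [eq_sub_iff_add_eq]
    exact_mod_cast hG
  have hsum : ∑ b, ({x | f x = b}.ncard : ℤ) = Nat.card G := mod_cast sum_ncard_fiber f
  have h₁ : ∑ b, (({x | f x = b}.ncard : ℤ) - P) = -1 := by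
    simp [Finset.sum_sub_distrib, hsum, hcard]
  have h₂ : ∑ b, (({x | f x = b}.ncard : ℤ) - P) ^ 2 = 1 := by
    simp only [sub_sq, Finset.sum_add_distrib, Finset.sum_sub_distrib, ← Finset.sum_mul,
      ← Finset.mul_sum, hsum, hd.sum_sq_ncard_fiber, hcard, Finset.sum_const, Finset.card_univ,
      ← Nat.card_eq_fintype_card, nsmul_eq_mul]
    ring
  obtain ⟨c, hc, hne⟩ := exists_eq_neg_one_of_sum_eq h₁ h₂
  simp only [hasBalancedFibers_sub_const_iff]
  refine ⟨c, ⟨by omega, fun b hb => by have := hne b hb; omega⟩, fun c' hc' => ?_⟩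
  by_contra hcc'
  have := hc'.1
  have := hne c' hcc'
  omega

end BalancedTranslate

section Homogeneous

open MonoidAlgebra CyclotomicInt

variable {p : ℕ} [hp : Fact p.Prime] {G : Type*} [CommGroup G]

theorem HasBalancedDifferences.prime_pow_dvd_sum_char_add_one [Fintype G] {k P : ℕ}
    {f : G → ZMod p} (hd : HasBalancedDifferences P f) (hf : HasBalancedFibers P f)
    (hG : Nat.card G + 1 = p ^ k) (t : (ZMod p)ˣ) (a : G) :
    (p : CyclotomicInt p) ^ k ∣ ∑ y, char p (f (a * y) - t * f y) + 1 := by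
  let u (t : (ZMod p)ˣ) : MonoidAlgebra (CyclotomicInt p) G :=
    groupSum fun x => char p (-t * f x⁻¹)
  let v : MonoidAlgebra (CyclotomicInt p) G := groupSum fun x => char p (f x) - 1
  have hcoeff (t : (ZMod p)ˣ) (a : G) :
      (u t * v).coeff a = ∑ y, char p (f (a * y) - t * f y) + 1 := by
    rw [mul_comm, coeff_groupSum_mul_groupSum_inv (β := fun x => char p (-t * f x))]
    simp only [sub_mul, one_mul, Finset.sum_sub_distrib, ← AddChar.map_add_eq_mul]
    rw [(hf.mul_left (neg_ne_zero.2 t.ne_zero)).sum_addChar char_ne_one, sub_neg_eq_add]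
    simp only [neg_mul, sub_eq_add_neg]
  have hgalois : mapRingHom G (galois t) (u 1) = u t := by
    simp [u, groupSum, galois_char]
  have hdvd (a : G) : (p : CyclotomicInt p) ^ k ∣ (u 1 * v).coeff a := by
    rw [hcoeff]
    obtain rfl | ha := eq_or_ne a 1
    · refine dvd_of_eq ?_
      simp only [Units.val_one, one_mul, sub_self, AddChar.map_zero_eq_one, Finset.sum_const,
        Finset.card_univ, ← Nat.card_eq_fintype_card, nsmul_one]
      exact_mod_cast hG.symm
    · simp only [Units.val_one, one_mul]
      rw [(hd a ha).sum_addChar char_ne_one, neg_add_cancel]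
      exact dvd_zero _
  rw [← hcoeff, ← hgalois]
  exact prime_pow_dvd_coeff_map_galois_mul hG t hdvd a

/-- The group of all `a` such that `f (a x)` is a nonzero multiple of `f x`, uniformly in `x`. -/
def scalingSubgroup {F : Type*} [Field F] (f : G → F) : Subgroup G where
  carrier := {a | ∃ t : Fˣ, ∀ x, f (a * x) = t * f x}
  one_mem' := ⟨1, by simp⟩
  mul_mem' := by
    rintro a b ⟨s, hs⟩ ⟨t, ht⟩
    exact ⟨s * t, fun x => by rw [mul_assoc, hs, ht, Units.val_mul, mul_assoc]⟩
  inv_mem' := by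
    rintro a ⟨t, ht⟩
    exact ⟨t⁻¹, fun x => by rw [Units.eq_inv_mul_iff_mul_eq, ← ht, mul_inv_cancel_left]⟩

variable [Finite G] {k : ℕ} {f : G → ZMod p}

namespace HasBalancedDifferences

theorem hasBalancedFibers_sub_mul_or_forall_eq (hd : HasBalancedDifferences (p ^ k) f)
    (hf : HasBalancedFibers (p ^ k) f) (hG : Nat.card G + 1 = p ^ (k + 1)) (t : (ZMod p)ˣ)
    (a : G) :
    HasBalancedFibers (p ^ k) (fun x => f (a * x) - t * f x) ∨ ∀ x, f (a * x) = t * f x := by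
  have := Fintype.ofFinite G
  have hdvd := hd.prime_pow_dvd_sum_char_add_one hf hG t a
  rw [pow_succ'] at hdvd hG
  simp only [← sub_eq_zero (b := (t : ZMod p) * _)]
  exact hasBalancedFibers_or_forall_eq_zero hG (by exact_mod_cast hdvd)

theorem exists_forall_eq_mul (hd : HasBalancedDifferences (p ^ k) f)
    (hf : HasBalancedFibers (p ^ k) f) (hG : Nat.card G + 1 = p ^ (k + 1)) (t : (ZMod p)ˣ) :
    ∃ a : G, ∀ x, f (a * x) = t * f x := by
  classical
  have := Fintype.ofFinite G
  by_contra! hne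
  have hcoincidence (a : G) : {x | f (a * x) = t * f x}.ncard + 1 = p ^ k := by
    obtain ⟨x, hx⟩ := hne a
    have hbal := (hd.hasBalancedFibers_sub_mul_or_forall_eq hf hG t a).resolve_right (hx <| · x)
    simpa only [sub_eq_zero] using (hasBalancedFibers_iff.1 hbal).1
  obtain ⟨hzero, hnonzero⟩ := hasBalancedFibers_iff.1 hf
  have hfiber (y : G) : {x | f x = t * f y}.ncard + (if f y = 0 then 1 else 0) = p ^ k := by
    split_ifs with hy
    · rw [hy, mul_zero, hzero]
    · rw [hnonzero _ (mul_ne_zero t.ne_zero hy), add_zero]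
  have hsum := sum_ncard_fiber_eq_sum_ncard_coincidence f fun x => t * f x
  have hsum₁ : ∑ a, {x | f (a * x) = t * f x}.ncard + Nat.card G = Nat.card G * p ^ k := by
    have := congrArg (∑ a, · a) (funext hcoincidence)
    simpa [Finset.sum_add_distrib] using this
  have hsum₂ : ∑ y, {x | f x = t * f y}.ncard + {y | f y = 0}.ncard = Nat.card G * p ^ k := by
    rw [ncard_setOf_eq_sum_ite fun y => f y = 0, ← Finset.sum_add_distrib]
    simp [hfiber]
  have : p ^ k < p ^ (k + 1) := Nat.pow_lt_pow_succ hp.out.one_lt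
  omega

theorem eq_of_forall_eq (hd : HasBalancedDifferences (p ^ k) f) {a b : G}
    (hab : ∀ x, f (a * x) = f (b * x)) : a = b := by
  by_contra hne
  obtain ⟨x, hx⟩ := (hd (a * b⁻¹) (mul_inv_eq_one.not.2 hne)).exists_eq
    (pow_pos hp.out.pos k).ne' one_ne_zero
  have := hab (b⁻¹ * x)
  simp_all [mul_assoc]

theorem card_scalingSubgroup (hd : HasBalancedDifferences (p ^ k) f)
    (hf : HasBalancedFibers (p ^ k) f) (hG : Nat.card G + 1 = p ^ (k + 1)) :
    Nat.card (scalingSubgroup f) = p - 1 := by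
  choose a ha using hd.exists_forall_eq_mul hf hG
  have hbij : Function.Bijective fun t => (⟨a t, t, ha t⟩ : scalingSubgroup f) := by
    refine ⟨fun s t hst => ?_, fun ⟨b, t, hb⟩ => ⟨t, Subtype.ext (hd.eq_of_forall_eq fun x => ?_)⟩⟩
    · obtain ⟨x, hx⟩ := hf.exists_eq (pow_pos hp.out.pos k).ne' one_ne_zero
      have hst : a s = a t := congrArg Subtype.val hst
      refine Units.ext ?_
      rw [← mul_one (s : ZMod p), ← mul_one (t : ZMod p), ← hx, ← ha, ← ha, hst]
    · rw [ha, hb]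
  rw [← Nat.card_eq_of_bijective _ hbij, Nat.card_eq_fintype_card, ZMod.card_units]

theorem hasBalancedFibers_sub_mul (hd : HasBalancedDifferences (p ^ k) f)
    (hf : HasBalancedFibers (p ^ k) f) (hG : Nat.card G + 1 = p ^ (k + 1)) {a : G}
    (ha : a ∉ scalingSubgroup f) (t : ZMod p) :
    HasBalancedFibers (p ^ k) fun x => f (a * x) - t * f x := by
  obtain rfl | ht := eq_or_ne t 0
  · simpa using hf.comp_equiv (Equiv.mulLeft a)
  · exact (hd.hasBalancedFibers_sub_mul_or_forall_eq hf hG (Units.mk0 t ht) a).resolve_right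
      fun h => ha ⟨_, h⟩

end HasBalancedDifferences

end Homogeneous

section PairCounting

theorem Equidistributed.card_mul_ncard_pair {Y F : Type*} [Finite Y] [Field F] [Finite F] {P : ℕ}
    {g h : Y → F} (hg : Equidistributed P g)
    (hgh : ∀ t : F, Equidistributed P fun y => h y - t * g y) (b : F × F) :
    Nat.card F * {y | (g y, h y) = b}.ncard = P := by
  classical
  have := Fintype.ofFinite Y
  have := Fintype.ofFinite F
  obtain ⟨b₁, b₂⟩ := b
  -- Count the pairs `(t, y)` such that the line of slope `t` through `b` contains `(g y, h y)`.
  have hlines (y : Y) : (∑ t : F, if h y - t * g y = b₂ - t * b₁ then 1 else 0) +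
      (if g y = b₁ then 1 else 0) = 1 + Nat.card F * if (g y, h y) = (b₁, b₂) then 1 else 0 := by
    obtain hy | hy := eq_or_ne (g y) b₁
    · by_cases hy' : h y = b₂ <;> simp [hy, hy', add_comm]
    · have hslope (t : F) :
          h y - t * g y = b₂ - t * b₁ ↔ t = (h y - b₂) / (g y - b₁) := by
        rw [eq_div_iff (sub_ne_zero.2 hy), mul_sub]
        grind
      simp [hslope, hy]
  have hcount : ∑ t : F, {y | h y - t * g y = b₂ - t * b₁}.ncard + {y | g y = b₁}.ncard =
      Nat.card Y + Nat.card F * {y | (g y, h y) = (b₁, b₂)}.ncard := by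
    simp only [ncard_setOf_eq_sum_ite]
    rw [Finset.sum_comm, ← Finset.sum_add_distrib, Finset.sum_congr rfl fun y _ => hlines y,
      Finset.sum_add_distrib, ← Finset.mul_sum]
    simp
  have hY : Nat.card Y = Nat.card F * P := by
    rw [← sum_ncard_fiber g, Finset.sum_congr rfl fun b _ => hg b]
    simp
  rw [hg b₁, Finset.sum_congr rfl fun t _ => hgh t _, Finset.sum_const, Finset.card_univ,
    smul_eq_mul, ← Nat.card_eq_fintype_card, ← hY] at hcount
  exact (Nat.add_left_cancel hcount).symm

variable {p k : ℕ} [hp : Fact p.Prime] {G : Type*} [CommGroup G] [Finite G] {f : G → ZMod p}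

theorem HasBalancedDifferences.hasBalancedFibers_pair (hd : HasBalancedDifferences (p ^ k) f)
    (hf : HasBalancedFibers (p ^ k) f) (hG : Nat.card G + 1 = p ^ (k + 1)) {a : G}
    (ha : a ∉ scalingSubgroup f) :
    HasBalancedFibers (p ^ (k - 1)) fun x => (f x, f (a * x)) := by
  have hsub (t : ZMod p) : Equidistributed (p ^ k)
      fun o => extendZero (fun x => f (a * x)) o - t * extendZero f o := by
    convert show Equidistributed _ _ from hd.hasBalancedFibers_sub_mul hf hG ha t using 2 with o
    cases o <;> simp [extendZero]
  have hpair := Equidistributed.card_mul_ncard_pair hf hsub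
  rw [Nat.card_zmod] at hpair
  obtain ⟨j, rfl⟩ : ∃ j, k = j + 1 := by
    refine Nat.exists_eq_succ_of_ne_zero ?_
    rintro rfl
    exact hp.out.ne_one (Nat.eq_one_of_mul_eq_one_right (hpair 0))
  intro b
  refine Nat.eq_of_mul_eq_mul_left hp.out.pos ?_
  rw [Nat.add_sub_cancel, ← pow_succ', ← hpair b]
  congr! 4 with o
  cases o <;> rfl

end PairCounting

section DifferenceSet

variable {G : Type*} [CommGroup G]

theorem differenceCount_eq_ncard (D : Set G) {g : G} (hg : g ≠ 1) :
    differenceCount D g = {x | x ∈ D ∧ g * x ∈ D}.ncard := by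
  rw [differenceCount, ← Set.ncard_image_of_injective {x | x ∈ D ∧ g * x ∈ D}
    (f := fun x => (g * x, x)) fun x y h => (Prod.mk.inj h).2]
  congr 1
  ext ⟨d₁, d₂⟩
  constructor
  · rintro ⟨h₁, h₂, -, rfl⟩
    exact ⟨d₂, ⟨h₂, by simpa using h₁⟩, by simp⟩
  · rintro ⟨x, ⟨h₁, h₂⟩, hx⟩
    obtain ⟨rfl, rfl⟩ := Prod.mk.inj hx
    exact ⟨h₂, h₁, fun h => hg (mul_eq_right.1 h), mul_inv_cancel_right _ _⟩

theorem IsDifferenceSet.of_ncard_preimage_mk [Finite G] {N : Subgroup G} {v k lam : ℕ}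
    {S : Set (G ⧸ N)} {D : Set G} (hD : ∀ x, QuotientGroup.mk' N x ∈ S ↔ x ∈ D)
    (hv : Nat.card G = v * Nat.card N) (hk : D.ncard = Nat.card N * k)
    (hlam : ∀ a ∉ N, {x | x ∈ D ∧ a * x ∈ D}.ncard = Nat.card N * lam) :
    IsDifferenceSet v k lam S := by
  have hcard (T : Set (G ⧸ N)) : Nat.card N * T.ncard = (QuotientGroup.mk' N ⁻¹' T).ncard :=
    (QuotientGroup.card_preimage_mk N T).symm
  refine ⟨?_, ?_, fun g hg => ?_⟩
  · rw [Subgroup.card_eq_card_quotient_mul_card_subgroup N] at hv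
    exact Nat.eq_of_mul_eq_mul_right Nat.card_pos hv
  · refine Nat.eq_of_mul_eq_mul_left Nat.card_pos ((hcard S).trans ?_)
    rw [← hk]
    exact congrArg Set.ncard (Set.ext hD)
  · obtain ⟨a, rfl⟩ := QuotientGroup.mk'_surjective N g
    have ha : a ∉ N := fun ha => hg ((QuotientGroup.eq_one_iff a).2 ha)
    refine Nat.eq_of_mul_eq_mul_left Nat.card_pos (Eq.trans ?_ (hlam a ha))
    rw [differenceCount_eq_ncard S hg, hcard]
    simp only [← hD, map_mul, Set.preimage_ofPred_eq]

theorem mk_mem_image_mk_iff {N : Subgroup G} {D : Set G} {x : G} :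
    QuotientGroup.mk' N x ∈ QuotientGroup.mk' N '' D ↔ ∃ a ∈ N, a * x ∈ D := by
  have := Set.ext_iff.1 (QuotientGroup.preimage_image_mk N D) x
  simpa [mul_comm] using this

theorem mk_mem_image_fiber_zero_iff {F : Type*} [Field F] {f : G → F} {x : G} :
    QuotientGroup.mk' (scalingSubgroup f) x ∈
      QuotientGroup.mk' (scalingSubgroup f) '' {x | f x = 0} ↔ f x = 0 := by
  rw [mk_mem_image_mk_iff]
  refine ⟨?_, fun hx => ⟨1, one_mem _, by simpa using hx⟩⟩
  rintro ⟨a, ⟨t, ht⟩, hx⟩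
  exact (mul_eq_zero_iff_left t.ne_zero).1 ((ht x).symm.trans hx)

theorem card_eq_div_sub_one_mul {p k : ℕ} {G : Type*} (hG : Nat.card G + 1 = p ^ k) :
    Nat.card G = (p ^ k - 1) / (p - 1) * (p - 1) := by
  rw [Nat.div_mul_cancel (Nat.sub_one_dvd_pow_sub_one p k), ← hG, Nat.add_sub_cancel]

end DifferenceSet

namespace HasBalancedDifferences

variable {p k : ℕ} [hp : Fact p.Prime] {G : Type*} [CommGroup G] [Finite G] {f : G → ZMod p}

theorem isRelativeDifferenceSet_fiber (hd : HasBalancedDifferences (p ^ k) f)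
    (hf : HasBalancedFibers (p ^ k) f) (hG : Nat.card G + 1 = p ^ (k + 1)) {b : ZMod p}
    (hb : b ≠ 0) :
    IsRelativeDifferenceSet (scalingSubgroup f) ((p ^ (k + 1) - 1) / (p - 1)) (p - 1) (p ^ k)
      (p ^ (k - 1)) {x | f x = b} := by
  refine ⟨card_eq_div_sub_one_mul hG, hd.card_scalingSubgroup hf hG,
    (hasBalancedFibers_iff.1 hf).2 b hb, fun g hg hg1 => ?_, fun g hg => ?_⟩
  · obtain ⟨t, ht⟩ := hg
    rw [differenceCount_eq_ncard _ hg1, Set.ncard_eq_zero, Set.eq_empty_iff_forall_notMem]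
    rintro x ⟨hx : f x = b, hgx : f (g * x) = b⟩
    have ht1 : (t : ZMod p) = 1 := (mul_eq_right₀ hb).1 (by rwa [ht, hx] at hgx)
    exact hg1 (hd.eq_of_forall_eq fun x => by rw [ht, ht1, one_mul, one_mul])
  · rw [differenceCount_eq_ncard _ (ne_of_mem_of_not_mem (one_mem _) hg).symm]
    have := (hasBalancedFibers_iff.1 (hd.hasBalancedFibers_pair hf hG hg)).2 (b, b) (by simp [hb])
    simpa using this

theorem isDivisibleDifferenceSet_fiber_zero (hd : HasBalancedDifferences (p ^ k) f)
    (hf : HasBalancedFibers (p ^ k) f) (hG : Nat.card G + 1 = p ^ (k + 1)) :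
    IsDivisibleDifferenceSet (scalingSubgroup f) ((p ^ (k + 1) - 1) / (p - 1)) (p - 1)
      (p ^ k - 1) (p ^ k - 1) (p ^ (k - 1) - 1) {x | f x = 0} := by
  have hzero := Nat.eq_sub_of_add_eq (hasBalancedFibers_iff.1 hf).1
  refine ⟨card_eq_div_sub_one_mul hG, hd.card_scalingSubgroup hf hG, hzero,
    fun g hg hg1 => ?_, fun g hg => ?_⟩
  · obtain ⟨t, ht⟩ := hg
    rw [differenceCount_eq_ncard _ hg1, ← hzero]
    simp [ht]
  · rw [differenceCount_eq_ncard _ (ne_of_mem_of_not_mem (one_mem _) hg).symm]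
    have := (hasBalancedFibers_iff.1 (hd.hasBalancedFibers_pair hf hG hg)).1
    exact Nat.eq_sub_of_add_eq (by simpa using this)

theorem mk_mem_image_fiber_iff (hd : HasBalancedDifferences (p ^ k) f)
    (hf : HasBalancedFibers (p ^ k) f) (hG : Nat.card G + 1 = p ^ (k + 1)) {b : ZMod p}
    (hb : b ≠ 0) {x : G} :
    QuotientGroup.mk' (scalingSubgroup f) x ∈
      QuotientGroup.mk' (scalingSubgroup f) '' {x | f x = b} ↔ f x ≠ 0 := by
  rw [mk_mem_image_mk_iff]
  constructor
  · rintro ⟨a, ⟨t, ht⟩, hx⟩ h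
    exact hb (by rw [← show f (a * x) = b from hx, ht, h, mul_zero])
  · intro hx
    obtain ⟨a, ha⟩ := hd.exists_forall_eq_mul hf hG (Units.mk0 (b / f x) (div_ne_zero hb hx))
    exact ⟨a, ⟨_, ha⟩, (ha x).trans (div_mul_cancel₀ b hx)⟩

theorem isDifferenceSet_image_fiber_zero (hd : HasBalancedDifferences (p ^ k) f)
    (hf : HasBalancedFibers (p ^ k) f) (hG : Nat.card G + 1 = p ^ (k + 1)) :
    IsDifferenceSet ((p ^ (k + 1) - 1) / (p - 1)) ((p ^ k - 1) / (p - 1))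
      ((p ^ (k - 1) - 1) / (p - 1)) (QuotientGroup.mk' (scalingSubgroup f) '' {x | f x = 0}) := by
  have hN := hd.card_scalingSubgroup hf hG
  have hdvd (j : ℕ) : (p - 1) * ((p ^ j - 1) / (p - 1)) = p ^ j - 1 :=
    Nat.mul_div_cancel' (Nat.sub_one_dvd_pow_sub_one p j)
  refine .of_ncard_preimage_mk (D := {x | f x = 0}) (fun x => mk_mem_image_fiber_zero_iff)
    (hN ▸ card_eq_div_sub_one_mul hG) ?_ fun a ha => ?_
  · rw [hN, hdvd, Nat.eq_sub_of_add_eq (hasBalancedFibers_iff.1 hf).1]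
  · rw [hN, hdvd]
    have := (hasBalancedFibers_iff.1 (hd.hasBalancedFibers_pair hf hG ha)).1
    exact Nat.eq_sub_of_add_eq (by simpa using this)

theorem isDifferenceSet_image_fiber (hd : HasBalancedDifferences (p ^ k) f)
    (hf : HasBalancedFibers (p ^ k) f) (hG : Nat.card G + 1 = p ^ (k + 1)) {b : ZMod p}
    (hb : b ≠ 0) :
    IsDifferenceSet ((p ^ (k + 1) - 1) / (p - 1)) (p ^ k) (p ^ (k - 1) * (p - 1))
      (QuotientGroup.mk' (scalingSubgroup f) '' {x | f x = b}) := by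
  have hN := hd.card_scalingSubgroup hf hG
  have hne : ({0}ᶜ : Set (ZMod p)).ncard = p - 1 := by
    rw [Set.ncard_compl, Set.ncard_singleton, Nat.card_zmod]
  refine .of_ncard_preimage_mk (D := {x | f x ≠ 0})
    (fun x => hd.mk_mem_image_fiber_iff hf hG hb) (hN ▸ card_eq_div_sub_one_mul hG) ?_
    fun a ha => ?_
  · have := hf.ncard_preimage (S := {0}ᶜ) (by simp)
    rwa [hne, mul_comm, ← hN] at this
  · have := (hd.hasBalancedFibers_pair hf hG ha).ncard_preimage (S := {0}ᶜ ×ˢ {0}ᶜ) (by simp)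
    rw [hN]
    rwa [Set.ncard_prod, hne, ← mul_assoc, mul_comm] at this

theorem image_fiber_zero_eq_compl (hd : HasBalancedDifferences (p ^ k) f)
    (hf : HasBalancedFibers (p ^ k) f) (hG : Nat.card G + 1 = p ^ (k + 1)) {b : ZMod p}
    (hb : b ≠ 0) :
    QuotientGroup.mk' (scalingSubgroup f) '' {x | f x = 0} =
      (QuotientGroup.mk' (scalingSubgroup f) '' {x | f x = b})ᶜ := by
  ext y
  obtain ⟨x, rfl⟩ := QuotientGroup.mk'_surjective _ y
  rw [Set.mem_compl_iff, mk_mem_image_fiber_zero_iff, hd.mk_mem_image_fiber_iff hf hG hb, not_not]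

end HasBalancedDifferences

section Autocorrelation

variable {G : Type*} [CommGroup G] {θ : G}

theorem sum_range_natCard_pow [Fintype G] {M : Type*} [AddCommMonoid M]
    (hθ : ∀ x, x ∈ Subgroup.zpowers θ) (φ : G → M) :
    ∑ i ∈ Finset.range (Nat.card G), φ (θ ^ i) = ∑ x, φ x := by
  classical
  rw [← IsCyclic.image_range_card hθ, Finset.sum_image]
  rw [← orderOf_eq_card_of_forall_mem_zpowers hθ, Finset.coe_range]
  exact pow_injOn_Iio_orderOf

theorem autocorrelation_pow_eq_sum [Fintype G] {p : ℕ} (hθ : ∀ x, x ∈ Subgroup.zpowers θ) (ζ : ℂ)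
    (f : G → ZMod p) (τ : ℕ) :
    autocorrelation (Nat.card G) ζ (fun i => f (θ ^ i)) τ =
      ∑ x, ζ ^ (f (θ ^ τ * x) - f x).val := by
  rw [← sum_range_natCard_pow hθ, autocorrelation]
  simp only [pow_add, mul_comm]

theorem hasBalancedDifferences_iff_hasIdealAutocorrelation [Finite G] {p P : ℕ} [Fact p.Prime]
    (hG : Nat.card G + 1 = p * P) (hθ : ∀ x, x ∈ Subgroup.zpowers θ) {ζ : ℂ}
    (hζ : IsPrimitiveRoot ζ p) (f : G → ZMod p) :
    HasBalancedDifferences P f ↔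
      HasIdealAutocorrelation (Nat.card G) ζ fun i => f (θ ^ i) := by
  have := Fintype.ofFinite G
  simp only [HasBalancedDifferences, hasBalancedFibers_iff_sum_pow_eq_neg_one hG hζ,
    HasIdealAutocorrelation, autocorrelation_pow_eq_sum hθ]
  simp only [← orderOf_eq_card_of_forall_mem_zpowers hθ, orderOf_dvd_iff_pow_eq_one]
  refine ⟨fun h τ => ⟨fun hτ => ?_, h _⟩, fun h a ha => ?_⟩
  · simp [hτ, orderOf_eq_card_of_forall_mem_zpowers hθ]
  · obtain ⟨τ, rfl⟩ := mem_powers_iff_mem_zpowers.2 (hθ a)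
    exact (h τ).2 ha

end Autocorrelation

theorem HasBalancedDifferences.hasBalancedFibers_of_ncard_ne {G F : Type*} [Group G] [Finite G]
    [AddGroup F] [Finite F] {P : ℕ} {f : G → F} (hd : HasBalancedDifferences P f)
    (hG : Nat.card G + 1 = Nat.card F * P) (hf : {x | f x = 0}.ncard ≠ P) :
    HasBalancedFibers P f := by
  obtain ⟨c, hc, -⟩ := hd.existsUnique_hasBalancedFibers_sub hG
  obtain rfl : c = 0 := by
    by_contra hc0
    exact hf ((hasBalancedFibers_sub_const_iff.1 hc).2 0 (Ne.symm hc0))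
  simpa using hc

theorem corollary5p4_general (p n : ℕ) [hp : Fact p.Prime] {G : Type*} [CommGroup G] [Finite G]
    (hG : Nat.card G + 1 = p ^ n) (f : G → ZMod p) :
    (∀ (θ : G) (ζ : ℂ), (∀ x, x ∈ Subgroup.zpowers θ) → IsPrimitiveRoot ζ p →
      (HasBalancedDifferences (p ^ (n - 1)) f ↔
        HasIdealAutocorrelation (p ^ n - 1) ζ fun i => f (θ ^ i))) ∧
    (HasBalancedDifferences (p ^ (n - 1)) f →
      (∃! c : ZMod p, HasBalancedFibers (p ^ (n - 1)) fun x => f x - c) ∧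
      ({x | f x = 0}.ncard = p ^ (n - 1) - 1 →
        HasBalancedFibers (p ^ (n - 1)) f ∧
        (∀ a ∉ scalingSubgroup f, HasBalancedFibers (p ^ (n - 2)) fun x => (f x, f (a * x))) ∧
        (∀ b : ZMod p, b ≠ 0 →
          IsRelativeDifferenceSet (scalingSubgroup f)
            ((p ^ n - 1) / (p - 1)) (p - 1) (p ^ (n - 1)) (p ^ (n - 2)) {x | f x = b}) ∧
        IsDivisibleDifferenceSet (scalingSubgroup f)
          ((p ^ n - 1) / (p - 1)) (p - 1) (p ^ (n - 1) - 1) (p ^ (n - 1) - 1) (p ^ (n - 2) - 1)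
          {x | f x = 0} ∧
        (∀ b : ZMod p, b ≠ 0 →
          IsDifferenceSet ((p ^ n - 1) / (p - 1)) (p ^ (n - 1)) (p ^ (n - 2) * (p - 1))
            (QuotientGroup.mk' (scalingSubgroup f) '' {x | f x = b}) ∧
          QuotientGroup.mk' (scalingSubgroup f) '' {x | f x = 0} =
            (QuotientGroup.mk' (scalingSubgroup f) '' {x | f x = b})ᶜ) ∧
        IsDifferenceSet ((p ^ n - 1) / (p - 1)) ((p ^ (n - 1) - 1) / (p - 1))
          ((p ^ (n - 2) - 1) / (p - 1))
          (QuotientGroup.mk' (scalingSubgroup f) '' {x | f x = 0}))) := by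
  obtain ⟨k, rfl⟩ : ∃ k, n = k + 1 := by
    refine Nat.exists_eq_succ_of_ne_zero ?_
    rintro rfl
    exact Nat.card_pos.ne' (Nat.succ_injective hG)
  have hG' : Nat.card G + 1 = p * p ^ k := hG.trans (pow_succ' p k)
  have hGF : Nat.card G + 1 = Nat.card (ZMod p) * p ^ k := by rwa [Nat.card_zmod]
  refine ⟨fun θ ζ hθ hζ => ?_,
    fun hd => ⟨hd.existsUnique_hasBalancedFibers_sub hGF, fun hzero => ?_⟩⟩
  · rw [← Nat.eq_sub_of_add_eq hG]
    exact hasBalancedDifferences_iff_hasIdealAutocorrelation hG' hθ hζ f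
  rw [Nat.add_sub_cancel] at hd hzero
  have hf : HasBalancedFibers (p ^ k) f := hd.hasBalancedFibers_of_ncard_ne hGF
    (hzero.trans_ne (Nat.sub_lt (pow_pos hp.out.pos k) one_pos).ne)
  exact ⟨hf, fun a ha => hd.hasBalancedFibers_pair hf hG ha,
    fun b hb => hd.isRelativeDifferenceSet_fiber hf hG hb,
    hd.isDivisibleDifferenceSet_fiber_zero hf hG,
    fun b hb => ⟨hd.isDifferenceSet_image_fiber hf hG hb, hd.image_fiber_zero_eq_compl hf hG hb⟩,
    hd.isDifferenceSet_image_fiber_zero hf hG⟩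

section BaseUnits

theorem eq_of_natCard_eq_of_isCyclic {G : Type*} [CommGroup G] [IsCyclic G] [Finite G]
    {H H' : Subgroup G} (h : Nat.card H = Nat.card H') : H = H' := by
  have hker (H : Subgroup G) : H = (powMonoidHom (Nat.card H) : G →* G).ker := by
    refine Subgroup.eq_of_le_of_card_ge (fun x hx => ?_) ?_
    · exact congrArg Subtype.val (pow_card_eq_one' (x := (⟨x, hx⟩ : H)))
    · rw [IsCyclic.card_powMonoidHom_ker]
      exact Nat.gcd_le_right _ Nat.card_pos
  rw [hker H, hker H', h]

theorem card_baseUnits (F K : Type*) [Field F] [Field K] [Algebra F K] :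
    Nat.card (baseUnits F K) = Nat.card Fˣ :=
  (Nat.card_congr (MonoidHom.ofInjective
    (Units.map_injective (algebraMap F K).injective)).toEquiv).symm

end BaseUnits

section FiniteField

variable {p : ℕ} [hp : Fact p.Prime] {K : Type*} [Field K] [Finite K] {f : Kˣ → ZMod p}

theorem isBalanced_iff_hasBalancedFibers {n : ℕ} :
    IsBalanced p n f ↔ HasBalancedFibers (p ^ (n - 1)) f := by
  have hpos := pow_pos hp.out.pos (n - 1)
  rw [hasBalancedFibers_iff, IsBalanced]
  exact and_congr_left fun _ => by omega

theorem isDifferenceBalanced_iff_hasBalancedDifferences {n : ℕ} :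
    IsDifferenceBalanced p n f ↔ HasBalancedDifferences (p ^ (n - 1)) f := by
  simp only [IsDifferenceBalanced, isBalanced_iff_hasBalancedFibers, HasBalancedDifferences]

theorem baseUnits_eq_of_card_eq [Algebra (ZMod p) K] {H : Subgroup Kˣ} (hH : Nat.card H = p - 1) :
    baseUnits (ZMod p) K = H :=
  eq_of_natCard_eq_of_isCyclic <| by
    rw [card_baseUnits, hH, Nat.card_eq_fintype_card, ZMod.card_units]

theorem IsTwoTupleBalanced.of_hasBalancedFibers [Algebra (ZMod p) K] {n : ℕ}
    (hN : baseUnits (ZMod p) K = scalingSubgroup f) (hf : HasBalancedFibers (p ^ (n - 1)) f)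
    (hpair : ∀ a ∉ scalingSubgroup f,
      HasBalancedFibers (p ^ (n - 2)) fun x => (f x, f (a * x))) : IsTwoTupleBalanced p n f := by
  unfold IsTwoTupleBalanced
  rw [hN]
  refine ⟨fun a ha => ?_, ?_⟩
  · obtain ⟨hzero, hne⟩ := hasBalancedFibers_iff.1 (hpair a ha)
    exact ⟨Nat.eq_sub_of_add_eq hzero, fun b₁ b₂ => hne (b₁, b₂)⟩
  · rintro a ⟨t, ht⟩
    obtain ⟨hzero, hne⟩ := hasBalancedFibers_iff.1 hf
    have hgraph (b : ZMod p) : pairCount f a b (t * b) = {x | f x = b}.ncard := by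
      refine congrArg Set.ncard (Set.ext fun x => ?_)
      simp +contextual [ht]
    refine ⟨t, ht, ?_, fun b hb => (hgraph b).trans (hne b hb), fun b₁ b₂ hb => ?_⟩
    · rw [← Nat.eq_sub_of_add_eq hzero, ← hgraph, mul_zero]
    · rw [pairCount, Set.ncard_eq_zero, Set.eq_empty_iff_forall_notMem]
      intro x hx
      obtain ⟨rfl, rfl⟩ := Prod.mk.inj hx
      exact hb (ht x)

end FiniteField

theorem corollary5p4 (p n : ℕ) [Fact p.Prime] (K : Type*) [Field K] [Finite K]
    [Algebra (ZMod p) K] (hK : Nat.card K = p ^ n) (f : Kˣ → ZMod p) :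
    -- difference balance is equivalent to ideal two-level autocorrelation
    (∀ (θ : Kˣ) (ζ : ℂ), (∀ x : Kˣ, x ∈ Subgroup.zpowers θ) → IsPrimitiveRoot ζ p →
      (IsDifferenceBalanced p n f ↔
        HasIdealAutocorrelation (p ^ n - 1) ζ (fun i => f (θ ^ i)))) ∧
    (IsDifferenceBalanced p n f →
      -- exactly one translate of `f` is balanced, so that the normalization below is no loss
      (∃! c : ZMod p, IsBalanced p n (fun x => f x - c)) ∧
      -- the normalization: `f` has one zero less than it has preimages of other values
      ({x : Kˣ | f x = 0}.ncard = p ^ (n - 1) - 1 →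
        IsTwoTupleBalanced p n f ∧
        IsCyclic Kˣ ∧
        (∀ b : ZMod p, b ≠ 0 →
          IsRelativeDifferenceSet (baseUnits (ZMod p) K)
            ((p ^ n - 1) / (p - 1)) (p - 1) (p ^ (n - 1)) (p ^ (n - 2)) {x : Kˣ | f x = b}) ∧
        IsDivisibleDifferenceSet (baseUnits (ZMod p) K)
          ((p ^ n - 1) / (p - 1)) (p - 1) (p ^ (n - 1) - 1) (p ^ (n - 1) - 1) (p ^ (n - 2) - 1)
          {x : Kˣ | f x = 0} ∧
        IsCyclic (Kˣ ⧸ baseUnits (ZMod p) K) ∧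
        (∀ b : ZMod p, b ≠ 0 →
          IsDifferenceSet ((p ^ n - 1) / (p - 1)) (p ^ (n - 1)) (p ^ (n - 2) * (p - 1))
            (QuotientGroup.mk' (baseUnits (ZMod p) K) '' {x : Kˣ | f x = b}) ∧
          QuotientGroup.mk' (baseUnits (ZMod p) K) '' {x : Kˣ | f x = 0} =
            (QuotientGroup.mk' (baseUnits (ZMod p) K) '' {x : Kˣ | f x = b})ᶜ) ∧
        IsDifferenceSet ((p ^ n - 1) / (p - 1)) ((p ^ (n - 1) - 1) / (p - 1))
          ((p ^ (n - 2) - 1) / (p - 1))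
          (QuotientGroup.mk' (baseUnits (ZMod p) K) '' {x : Kˣ | f x = 0}))) := by
  have hp : p ≠ 0 := NeZero.ne p
  have hG : Nat.card Kˣ + 1 = p ^ n := by
    rw [Nat.card_units, hK, Nat.sub_add_cancel (Nat.one_le_pow n p hp.bot_lt)]
  obtain ⟨hauto, hdiff⟩ := corollary5p4_general p n hG f
  simp only [isDifferenceBalanced_iff_hasBalancedDifferences, isBalanced_iff_hasBalancedFibers]
  refine ⟨hauto, fun hd => ⟨(hdiff hd).1, fun hzero => ?_⟩⟩
  obtain ⟨hf, hpair, hrel, hdiv, himage, himage₀⟩ := (hdiff hd).2 hzero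
  have hN := baseUnits_eq_of_card_eq hdiv.card_subgroup
  rw [hN]
  exact ⟨.of_hasBalancedFibers hN hf hpair, inferInstance, hrel, hdiv, inferInstance, himage,
    himage₀⟩
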